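/- **Lemma.** The following decision problem is undecidable. *Instance:* a finite, locally confluent, linear term rewrite system (TRS) $\mathcal R$. *Question:* are all critical pairs of $\mathcal R$ locally decreasing with respect to the rule-labeling heuristic? That is, is there a well-founded (strict) order $>$ on the rules of $\mathcal R$ such that, for all rules $\alpha,\beta\in\mathcal R$ and every critical pair $s\approx t$ obtained from an overlap $(\alpha,p,\beta)_\mu$ (so that $s$ results from the step with $\alpha$ at position $p$ and $t$ from the root step with $\beta$), there are terms with $$ s \to_{<\alpha}^{*}\cdot\to_{\leqslant\beta}^{=}\cdot\to_{<\alpha\beta}^{*}\; u \;\;{}_{<\alpha\beta}^{\;\;\;*}{\leftarrow}\cdot{}_{\leqslant\alpha}^{\;\;\;=}{\leftarrow}\cdot{}_{<\beta}^{\;\;*}{\leftarrow}\; t\,? $$ Here $\to_{<\alpha}$ (resp. $\to_{\leqslant\alpha}$) is the union of the rewrite relations $\to_\gamma$ of the rules $\gamma\in\mathcal R$ with $\gamma<\alpha$ (resp. $\gamma<\alpha$ or $\gamma=\alpha$), ${\to_{<\alpha\beta}}={\to_{<\alpha}}\cup{\to_{<\beta}}$, $\to^{*}$ is the reflexive-transitive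 closure and $\to^{=}$ the reflexive closure. The left-hand side of a rewrite rule is not a variable and contains all variables of its right-hand side; a TRS is linear if no variable occurs twice in a left-hand side or twice in a right-hand side; it is locally confluent if $t\leftarrow s\to u$ always implies that $t$ and $u$ have a common reduct. An overlap $(\alpha,p,\beta)_\mu$ consists of variants $l_1\to r_1$ of $\alpha$ and $l_2\to r_2$ of $\beta$ without common variables, a non-variable position $p$ of $l_2$ and a most general unifier $\mu$ of $l_1$ and $l_2|_p$, where the two rules are not variants of each other if $p$ is the root position; its critical pair is $l_2\mu[r_1\mu]_p\approx r_2\mu$. Undecidable means: there is no partial recursive procedure which, on every finite, locally confluent, linear TRS (suitably encoded), halts with the correct answer; its behaviour on other inputs is unconstrained. -/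

import Mathlib

namespace TRS

/-- The universal signature: for every arity `k` there are countably many function symbols of
arity `k` (a symbol is a pair of an arity and a name), and there are no relation symbols.
Every finite signature embeds into it. -/
abbrev sig : FirstOrder.Language.{0, 0} := ⟨fun _ => ℕ, fun _ => Empty⟩

/-- First-order terms over `sig`, with variables taken from `ℕ`. -/
abbrev Term : Type := sig.Term ℕ

open FirstOrder.Language

/-- The variable occurrences of a term, from left to right. -/
def varList : Term → List ℕ
  | .var x => [x]
  | .func _ ts => (List.finRange _).flatMap fun i => varList (ts i)

def IsVar (t : Term) : Prop := ∃ x : ℕ, t = Term.var x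

/-- No variable occurs more than once. -/
def LinearTerm (t : Term) : Prop := (varList t).Nodup

/-- The subterm of a term at a position; `none` if it is not a position of the term. -/
def subtermAt : Term → List ℕ → Option Term
  | t, [] => some t
  | .var _, _ :: _ => none
  | @Term.func _ _ l _ ts, i :: p => if h : i < l then subtermAt (ts ⟨i, h⟩) p else none

/-- `replaceAt t p u` is the term `t[u]_p`, for a position `p` of `t`. -/
def replaceAt : Term → List ℕ → Term → Term
  | _, [], u => u
  | .var x, _ :: _, _ => .var x
  | .func f ts, i :: p, u =>
      .func f fun j => if (j : ℕ) = i then replaceAt (ts j) p u else ts j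

/-- A pair of terms `lhs → rhs`. -/
@[ext]
structure Rule where
  lhs : Term
  rhs : Term

/-- The left-hand side is not a variable, and every variable of the right-hand side
occurs in the left-hand side. -/
def Rule.IsRewriteRule (ρ : Rule) : Prop :=
  ¬ IsVar ρ.lhs ∧ varList ρ.rhs ⊆ varList ρ.lhs

def Rule.Linear (ρ : Rule) : Prop := LinearTerm ρ.lhs ∧ LinearTerm ρ.rhs

/-- The variables that occur in a rule. -/
def Rule.vars (ρ : Rule) : List ℕ := varList ρ.lhs ++ varList ρ.rhs

/-- `ρ'` is a variant of `ρ`: it arises by a bijective renaming of the variables. -/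
def IsVariant (ρ' ρ : Rule) : Prop :=
  ∃ e : Equiv.Perm ℕ, ρ'.lhs = ρ.lhs.relabel e ∧ ρ'.rhs = ρ.rhs.relabel e

/-- A finite term rewrite system, listed. -/
def IsTRS (R : List Rule) : Prop := ∀ ρ ∈ R, ρ.IsRewriteRule

def LinearTRS (R : List Rule) : Prop := ∀ ρ ∈ R, ρ.Linear

/-- The rewrite relation of a single rule: the closure of the rule under substitutions and
contexts. -/
inductive Step (ρ : Rule) : Term → Term → Prop
  | root (σ : ℕ → Term) : Step ρ (ρ.lhs.subst σ) (ρ.rhs.subst σ)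
  | arg {k : ℕ} (f : sig.Functions k) (ts : Fin k → Term) (i : Fin k) (t' : Term)
      (h : Step ρ (ts i) t') :
      Step ρ (Term.func f ts) (Term.func f (Function.update ts i t'))

/-- The rewrite relation of a term rewrite system. -/
def Rewrites (R : List Rule) (s t : Term) : Prop := ∃ ρ ∈ R, Step ρ s t

/-- Whenever `s → t` and `s → u`, the terms `t` and `u` have a common reduct. -/
def LocallyConfluent (R : List Rule) : Prop :=
  ∀ s t u : Term, Rewrites R s t → Rewrites R s u →
    Relation.Join (Relation.ReflTransGen (Rewrites R)) t u

/-- `μ` is a most general unifier of `s` and `t`. -/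
def IsMGU (μ : ℕ → Term) (s t : Term) : Prop :=
  s.subst μ = t.subst μ ∧
    ∀ ν : ℕ → Term, s.subst ν = t.subst ν → ∃ δ : ℕ → Term, ∀ x, ν x = (μ x).subst δ

/-- `(ρ₁, p, ρ₂)_μ` is an overlap between (variants of) the rules `α` and `β`. -/
structure IsOverlap (α β ρ₁ ρ₂ : Rule) (p : List ℕ) (μ : ℕ → Term) : Prop where
  variant_left : IsVariant ρ₁ α
  variant_right : IsVariant ρ₂ β
  disjoint : ρ₁.vars.Disjoint ρ₂.vars
  unify : ∃ u : Term, subtermAt ρ₂.lhs p = some u ∧ ¬ IsVar u ∧ IsMGU μ ρ₁.lhs u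
  root_not_variant : p = [] → ¬ IsVariant ρ₁ ρ₂

/-- `s ≈ t` is a critical pair that is induced by an overlap `(α, p, β)_μ`; the left component
`s` comes from the step with `α` and the right component `t` from the root step with `β`. -/
def CriticalPair (α β : Rule) (s t : Term) : Prop :=
  ∃ (ρ₁ ρ₂ : Rule) (p : List ℕ) (μ : ℕ → Term), IsOverlap α β ρ₁ ρ₂ p μ ∧
    s = replaceAt (ρ₂.lhs.subst μ) p (ρ₁.rhs.subst μ) ∧ t = ρ₂.rhs.subst μ

section RuleLabeling

variable {R : List Rule} (lt : {ρ // ρ ∈ R} → {ρ // ρ ∈ R} → Prop)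

/-- A step with a rule that is smaller than `α`. -/
def StepBelow (α : {ρ // ρ ∈ R}) (s t : Term) : Prop :=
  ∃ γ : {ρ // ρ ∈ R}, lt γ α ∧ Step γ.1 s t

/-- A step with a rule that is smaller than or equal to `β`. -/
def StepBelowEq (β : {ρ // ρ ∈ R}) (s t : Term) : Prop :=
  ∃ γ : {ρ // ρ ∈ R}, (lt γ β ∨ γ = β) ∧ Step γ.1 s t

/-- Any number of steps below `α`, then at most one step below or equal to `β`, then any number
of steps each of which is below `α` or below `β`. -/
def DecreasingSeq (α β : {ρ // ρ ∈ R}) (s u : Term) : Prop :=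
  ∃ s₁ s₂ : Term, Relation.ReflTransGen (StepBelow lt α) s s₁ ∧
    Relation.ReflGen (StepBelowEq lt β) s₁ s₂ ∧
    Relation.ReflTransGen (fun a b => StepBelow lt α a b ∨ StepBelow lt β a b) s₂ u

end RuleLabeling

/-- The critical pairs are all locally decreasing under the rule-labeling heuristic, where steps
are labeled by the rule that they employ: for some well-founded order on the rules,
every critical pair closes by a decreasing diagram. -/
def RuleLabelingDecreasing (R : List Rule) : Prop :=
  ∃ lt : {ρ // ρ ∈ R} → {ρ // ρ ∈ R} → Prop, IsStrictOrder {ρ // ρ ∈ R} lt ∧ WellFounded lt ∧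
    ∀ (α β : {ρ // ρ ∈ R}) (s t : Term), CriticalPair α.1 β.1 s t →
      ∃ u : Term, DecreasingSeq lt α β s u ∧ DecreasingSeq lt β α t u

/-- A token of a written term: a variable `x`, or a function symbol given by its arity and
its name. -/
abbrev Token : Type := ℕ ⊕ (ℕ × ℕ)

/-- A term, written as a word of tokens in Polish (prefix) notation. -/
def encodeTerm (t : Term) : List Token := t.listEncode.map (Sum.map id fun g => (g.1, g.2))

/-- A finite list of rules, written as a list of pairs of words. -/
def encodeTRS (R : List Rule) : List (List Token × List Token) :=
  R.map fun ρ => (encodeTerm ρ.lhs, encodeTerm ρ.rhs)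

theorem encodeTerm_injective : Function.Injective encodeTerm := by
  intro s t h
  have hinj : Function.Injective
      (Sum.map id (fun g => (g.1, g.2)) : ℕ ⊕ (Σ k, sig.Functions k) → Token) := by
    refine Function.Injective.sumMap Function.injective_id ?_
    rintro ⟨a, b⟩ ⟨c, d⟩ h
    simp only [Prod.mk.injEq] at h
    obtain ⟨rfl, h⟩ := h
    cases h
    rfl
  have h' : s.listEncode = t.listEncode := List.map_injective_iff.mpr hinj h
  have hs := Term.listDecode_encode_list [s]
  have ht := Term.listDecode_encode_list [t]
  simp only [List.flatMap_cons, List.flatMap_nil, List.append_nil] at hs ht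
  rw [h', ht] at hs
  simpa using hs.symm

theorem encodeTRS_injective : Function.Injective encodeTRS := by
  refine List.map_injective_iff.mpr fun ρ ρ' h => ?_
  simp only [Prod.mk.injEq] at h
  exact Rule.ext (encodeTerm_injective h.1) (encodeTerm_injective h.2)

end TRS

/-!
The halting problem of a stack machine reduces to rule-labeling decreasingness. For a deterministic
machine `M` with four stacks, every transition becomes a linear rewrite rule on terms
`q(s₁, s₂, s₃, s₄)`, where `q` is the state and the `sᵢ` are the stacks, and these rules do not
overlap. A halting configuration is rewritten to the pair `p(1, 0)`. For an initial configuration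
`c`, two further rules are added:

  `α : p(0, 1) → c`,    `β : p(x, y) → p(y, x)`.

The only critical pair, up to symmetry, is `c ≈ p(1, 0)`. It is always joinable, by
`p(1, 0) →β p(0, 1) →α c`, so the system is locally confluent
(`StackMachine.locallyConfluent_toTRS`).

If `M` halts from `c`, then `c` reaches `p(1, 0)` with machine rules only, and the critical pair is
decreasing when these are put below `α` and `β` (`StackMachine.ruleLabelingDecreasing_of_dom`). If
`M` runs forever, then `c` rewrites to configurations only, and `p(1, 0)` has to get there by a
step with `β` that is later followed by a step with `α`. In a decreasing diagram the former forces
`β < α`, after which `α` may be used only if `α < α` or `α < β`; so there is no decreasing diagram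
(`StackMachine.dom_of_ruleLabelingDecreasing`).

All left-hand sides consist of a symbol of arity at least two that is applied to terms over symbols
of arity at most one. In such a constructor system rules overlap only at the root, and the step
from the joinability of root peaks to local confluence has a short proof
(`locallyConfluent_of_root_peaks`).

The machine is fixed: it runs Mathlib's `TM2` program for a universal partial recursive function
(`exists_undecidable_stackMachine`). Hence only the right-hand side of `α` depends on the input of
the machine, and the reduction is primitive recursive (`primrec_encodeTRS_toTRS`).
-/

namespace TRS

open FirstOrder.Language Relation

/-! ### Terms, substitutions and rewrite sequences -/

theorem subst_eq_subst_iff {t : Term} {σ τ : ℕ → Term} :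
    t.subst σ = t.subst τ ↔ ∀ x ∈ varList t, σ x = τ x := by
  induction t with
  | var x => simp [varList, Term.subst]
  | func f ts ih =>
    simp only [Term.subst, varList, List.mem_flatMap, List.mem_finRange, true_and,
      Term.func.injEq, heq_eq_eq, funext_iff, ih]
    exact ⟨fun h x ⟨i, hi⟩ => h i x hi, fun h i x hi => h x ⟨i, hi⟩⟩

theorem subst_relabel (t : Term) (e : ℕ → ℕ) (σ : ℕ → Term) :
    (t.relabel e).subst σ = t.subst (σ ∘ e) := by
  induction t with
  | var x => rfl
  | func f ts ih => simp [Term.subst, Term.relabel, ih]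

theorem Step.cases_root_or_arg {ρ : Rule} {s t : Term} (h : Step ρ s t) :
    (∃ σ, s = ρ.lhs.subst σ ∧ t = ρ.rhs.subst σ) ∨
      ∃ (k : ℕ) (f : sig.Functions k) (ts : Fin k → Term) (i : Fin k) (t' : Term),
        s = Term.func f ts ∧ t = Term.func f (Function.update ts i t') ∧ Step ρ (ts i) t' := by
  cases h with
  | root σ => exact .inl ⟨σ, rfl, rfl⟩
  | arg f ts i t' h => exact .inr ⟨_, f, ts, i, t', rfl, rfl, h⟩

theorem Rewrites.arg {R : List Rule} {k : ℕ} (f : sig.Functions k) (ts : Fin k → Term)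
    (i : Fin k) {t' : Term} (h : Rewrites R (ts i) t') :
    Rewrites R (Term.func f ts) (Term.func f (Function.update ts i t')) := by
  obtain ⟨ρ, hρ, h⟩ := h
  exact ⟨ρ, hρ, .arg f ts i t' h⟩

theorem reflTransGen_rewrites_update {R : List Rule} {k : ℕ} (f : sig.Functions k)
    (ts : Fin k → Term) (i : Fin k) {s t : Term} (h : ReflTransGen (Rewrites R) s t) :
    ReflTransGen (Rewrites R) (Term.func f (Function.update ts i s))
      (Term.func f (Function.update ts i t)) := by
  refine h.lift (fun u => Term.func f (Function.update ts i u)) fun a b hab => ?_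
  simpa using Rewrites.arg f (Function.update ts i a) i (t' := b) (by simpa using hab)

theorem reflTransGen_rewrites_func {R : List Rule} {k : ℕ} (f : sig.Functions k)
    {ts us : Fin k → Term} (h : ∀ i, ReflTransGen (Rewrites R) (ts i) (us i)) :
    ReflTransGen (Rewrites R) (Term.func f ts) (Term.func f us) := by
  suffices ∀ s : Finset (Fin k),
      ReflTransGen (Rewrites R) (Term.func f ts) (Term.func f (s.piecewise us ts)) by
    simpa using this Finset.univ
  intro s
  induction s using Finset.induction_on with
  | empty => simpa using ReflTransGen.refl
  | insert i s hi ih =>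
    refine ih.trans ?_
    rw [Finset.piecewise_insert]
    have := reflTransGen_rewrites_update f (s.piecewise us ts) i (h i)
    rwa [Function.update_eq_self_iff.mpr (by simp [hi])] at this

theorem reflTransGen_rewrites_subst {R : List Rule} {σ τ : ℕ → Term}
    (h : ∀ x, ReflTransGen (Rewrites R) (σ x) (τ x)) (t : Term) :
    ReflTransGen (Rewrites R) (t.subst σ) (t.subst τ) := by
  induction t with
  | var x => exact h x
  | func f ts ih => exact reflTransGen_rewrites_func f ih

theorem LinearTerm.args {k : ℕ} {f : sig.Functions k} {ts : Fin k → Term}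
    (h : LinearTerm (Term.func f ts)) (i : Fin k) : LinearTerm (ts i) := by
  simp only [LinearTerm, varList, List.nodup_flatMap] at h
  exact h.1 i (List.mem_finRange i)

theorem LinearTerm.disjoint_args {k : ℕ} {f : sig.Functions k} {ts : Fin k → Term}
    (h : LinearTerm (Term.func f ts)) {i j : Fin k} (hij : i ≠ j) :
    (varList (ts i)).Disjoint (varList (ts j)) := by
  simp only [LinearTerm, varList, List.nodup_flatMap] at h
  have : Std.Symm (Function.onFun List.Disjoint fun i => varList (ts i)) :=
    ⟨fun _ _ h => List.Disjoint.symm h⟩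
  exact h.2.forall (List.mem_finRange i) (List.mem_finRange j) hij

/-- By linearity, a change of the substitution at the variables of one argument does not affect
the other arguments. -/
theorem LinearTerm.func_update_subst {k : ℕ} {f : sig.Functions k} {ts : Fin k → Term}
    (h : LinearTerm (Term.func f ts)) {i : Fin k} {σ τ : ℕ → Term}
    (hτ : ∀ x, x ∉ varList (ts i) → τ x = σ x) :
    Term.func f (Function.update (fun j => (ts j).subst σ) i ((ts i).subst τ)) =
      (Term.func f ts).subst τ := by
  simp only [Term.subst, Term.func.injEq, heq_eq_eq, true_and]
  funext j
  obtain rfl | hj := eq_or_ne j i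
  · simp
  · rw [Function.update_of_ne hj]
    exact subst_eq_subst_iff.2 fun x hx => (hτ x fun hxi => h.disjoint_args hj hx hxi).symm

theorem Rewrites.root {R : List Rule} {ρ : Rule} (hρ : ρ ∈ R) (σ : ℕ → Term) :
    Rewrites R (ρ.lhs.subst σ) (ρ.rhs.subst σ) := ⟨ρ, hρ, .root σ⟩

/-! ### Constructor systems -/

/-- A term without defined symbols, where the symbols of arity at most one are taken as
constructors and all other symbols as defined symbols. -/
def IsConstructorTerm : Term → Prop
  | .var _ => True
  | @Term.func _ _ k _ ts => k ≤ 1 ∧ ∀ i, IsConstructorTerm (ts i)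

/-- The left-hand side is a defined symbol that is applied to constructor terms. -/
def Rule.IsConstructorRule (ρ : Rule) : Prop :=
  ∃ (k : ℕ) (f : sig.Functions k) (ts : Fin k → Term),
    ρ.lhs = Term.func f ts ∧ 2 ≤ k ∧ ∀ i, IsConstructorTerm (ts i)

theorem IsConstructorTerm.relabel {t : Term} (h : IsConstructorTerm t) (e : ℕ → ℕ) :
    IsConstructorTerm (t.relabel e) := by
  induction t with
  | var x => trivial
  | func f ts ih => exact ⟨h.1, fun i => ih i (h.2 i)⟩

theorem Rule.IsConstructorRule.of_isVariant {ρ ρ' : Rule} (h : ρ.IsConstructorRule)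
    (hv : IsVariant ρ' ρ) : ρ'.IsConstructorRule := by
  obtain ⟨k, f, ts, hl, hk, hts⟩ := h
  obtain ⟨e, he, -⟩ := hv
  exact ⟨k, f, fun i => (ts i).relabel e, by rw [he, hl]; rfl, hk, fun i => (hts i).relabel e⟩

theorem IsConstructorTerm.of_subtermAt {t u : Term} {p : List ℕ} (h : IsConstructorTerm t)
    (hu : subtermAt t p = some u) : IsConstructorTerm u := by
  induction t generalizing p with
  | var x => cases p <;> simp_all [subtermAt]
  | func f ts ih =>
    cases p with
    | nil => simp only [subtermAt, Option.some.injEq] at hu; exact hu ▸ h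
    | cons i p =>
      simp only [subtermAt] at hu
      split at hu
      · exact ih _ (h.2 _) hu
      · cases hu

theorem Rule.IsConstructorRule.lhs_subst_ne {ρ : Rule} (hρ : ρ.IsConstructorRule) {u : Term}
    (hu : IsConstructorTerm u) (hv : ¬ IsVar u) (σ τ : ℕ → Term) :
    ρ.lhs.subst σ ≠ u.subst τ := by
  obtain ⟨k, f, ts, hl, hk, -⟩ := hρ
  cases u with
  | var x => exact absurd ⟨x, rfl⟩ hv
  | func g us =>
    intro h
    rw [hl] at h
    simp only [Term.subst, Term.func.injEq] at h
    have := hu.1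
    lia

theorem Rule.IsConstructorRule.exists_eq_lhs_subst {ρ : Rule} (hρ : ρ.IsConstructorRule)
    {s : Term} {σ : ℕ → Term} (h : s = ρ.lhs.subst σ) :
    ∃ (k : ℕ) (f : sig.Functions k) (ts : Fin k → Term), s = Term.func f ts ∧ 2 ≤ k := by
  obtain ⟨k, f, ts, hl, hk, -⟩ := hρ
  exact ⟨k, f, fun i => (ts i).subst σ, by rw [h, hl]; rfl, hk⟩

/-- In a constructor system, a step from an instance of a linear constructor term happens inside
the substitution. -/
theorem IsConstructorTerm.exists_eq_subst_of_step {R : List Rule}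
    (hR : ∀ ρ ∈ R, ρ.IsConstructorRule) {t : Term} (ht : IsConstructorTerm t)
    (hl : LinearTerm t) {σ : ℕ → Term} {u : Term} (h : Rewrites R (t.subst σ) u) :
    ∃ τ : ℕ → Term, u = t.subst τ ∧ (∀ x, x ∉ varList t → τ x = σ x) ∧
      ∀ x, ReflTransGen (Rewrites R) (σ x) (τ x) := by
  induction t generalizing u with
  | var y =>
    refine ⟨Function.update σ y u, by simp [Term.subst], fun x hx => ?_, fun x => ?_⟩
    · simp only [varList, List.mem_singleton] at hx
      simp [hx]
    · obtain rfl | hx := eq_or_ne x y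
      · simpa using ReflTransGen.single h
      · simpa [hx] using ReflTransGen.refl
  | @func k f ts ih =>
    obtain ⟨ρ, hρ, h⟩ := h
    obtain ⟨σ', hs, -⟩ | ⟨k', f', ts', i, t', hs, rfl, h'⟩ := h.cases_root_or_arg
    · exact absurd hs.symm ((hR ρ hρ).lhs_subst_ne ht (by rintro ⟨x, hx⟩; cases hx) _ _)
    · simp only [Term.subst, Term.func.injEq] at hs
      obtain ⟨rfl, hf, hts⟩ := hs
      obtain rfl := eq_of_heq hf
      obtain rfl := eq_of_heq hts
      obtain ⟨τ, rfl, hτ, hτ'⟩ := ih i (ht.2 i) (hl.args i) ⟨ρ, hρ, h'⟩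
      refine ⟨τ, hl.func_update_subst hτ, fun x hx => hτ x fun hxi => hx ?_, hτ'⟩
      simp only [varList, List.mem_flatMap]
      exact ⟨i, List.mem_finRange i, hxi⟩

/-- A linear constructor system is locally confluent if its root peaks are joinable. -/
theorem locallyConfluent_of_root_peaks {R : List Rule} (hR : ∀ ρ ∈ R, ρ.IsConstructorRule)
    (hlin : LinearTRS R)
    (hpeak : ∀ ρ₁ ∈ R, ∀ ρ₂ ∈ R, ∀ σ₁ σ₂, ρ₁.lhs.subst σ₁ = ρ₂.lhs.subst σ₂ →
      Join (ReflTransGen (Rewrites R)) (ρ₁.rhs.subst σ₁) (ρ₂.rhs.subst σ₂)) :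
    LocallyConfluent R := by
  -- A root step commutes with a step inside an argument.
  have root_arg : ∀ ρ ∈ R, ∀ (σ : ℕ → Term) {k : ℕ} (f : sig.Functions k) (ts : Fin k → Term)
      (i : Fin k) (t' : Term), Term.func f ts = ρ.lhs.subst σ → Rewrites R (ts i) t' →
      Join (ReflTransGen (Rewrites R)) (ρ.rhs.subst σ)
        (Term.func f (Function.update ts i t')) := by
    intro ρ hρ σ k f ts i t' hs h
    obtain ⟨k', f', ts', hl, hk, hts'⟩ := hR ρ hρ
    have hlinρ := (hlin ρ hρ).1
    rw [hl] at hs hlinρ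
    simp only [Term.subst, Term.func.injEq] at hs
    obtain ⟨rfl, hf, hts⟩ := hs
    obtain rfl := eq_of_heq hf
    obtain rfl := eq_of_heq hts
    obtain ⟨τ, rfl, hτ, hτ'⟩ := (hts' i).exists_eq_subst_of_step hR (hlinρ.args i) h
    refine ⟨ρ.rhs.subst τ, reflTransGen_rewrites_subst hτ' _, .single ?_⟩
    rw [hlinρ.func_update_subst hτ, ← hl]
    exact Rewrites.root hρ τ
  intro s
  induction s with
  | var x =>
    rintro t u ⟨ρ, hρ, h⟩ -
    obtain ⟨σ, hs, -⟩ | ⟨k', f', ts', i, t', hs, -, -⟩ := h.cases_root_or_arg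
    · obtain ⟨k, f, ts, h, -⟩ := (hR ρ hρ).exists_eq_lhs_subst hs
      cases h
    · cases hs
  | @func k f ts ih =>
    rintro t u ⟨ρ₁, hρ₁, h₁⟩ ⟨ρ₂, hρ₂, h₂⟩
    obtain ⟨σ₁, hs₁, rfl⟩ | ⟨_, _, _, i, t', hs₁, rfl, h₁'⟩ := h₁.cases_root_or_arg <;>
    obtain ⟨σ₂, hs₂, rfl⟩ | ⟨_, _, _, j, u', hs₂, rfl, h₂'⟩ := h₂.cases_root_or_arg
    · exact hpeak ρ₁ hρ₁ ρ₂ hρ₂ σ₁ σ₂ (hs₁.symm.trans hs₂)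
    · cases hs₂
      exact root_arg ρ₁ hρ₁ σ₁ f ts j u' hs₁ ⟨ρ₂, hρ₂, h₂'⟩
    · cases hs₁
      obtain ⟨v, hv, hv'⟩ := root_arg ρ₂ hρ₂ σ₂ f ts i t' hs₂ ⟨ρ₁, hρ₁, h₁'⟩
      exact ⟨v, hv', hv⟩
    · cases hs₁
      cases hs₂
      obtain rfl | hij := eq_or_ne i j
      · obtain ⟨v, hv, hv'⟩ := ih i t' u' ⟨ρ₁, hρ₁, h₁'⟩ ⟨ρ₂, hρ₂, h₂'⟩
        exact ⟨_, reflTransGen_rewrites_update f ts i hv, reflTransGen_rewrites_update f ts i hv'⟩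
      · refine ⟨Term.func f (Function.update (Function.update ts i t') j u'), .single ?_,
          .single ?_⟩
        · refine Rewrites.arg f _ j ⟨ρ₂, hρ₂, ?_⟩
          rwa [Function.update_of_ne hij.symm]
        · rw [Function.update_comm hij]
          refine Rewrites.arg f _ i ⟨ρ₁, hρ₁, ?_⟩
          rwa [Function.update_of_ne hij]

/-- The critical pairs of a constructor system come from root overlaps of different rules. -/
theorem CriticalPair.exists_root_peak {α β : Rule} {s t : Term} (h : CriticalPair α β s t)
    (hα : α.IsConstructorRule) (hβ : β.IsConstructorRule) :
    α ≠ β ∧ ∃ σ τ : ℕ → Term, α.lhs.subst σ = β.lhs.subst τ ∧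
      s = α.rhs.subst σ ∧ t = β.rhs.subst τ := by
  obtain ⟨ρ₁, ρ₂, p, μ, ho, rfl, rfl⟩ := h
  obtain ⟨u, hu, hv, hμ, -⟩ := ho.unify
  have hρ₁ := hα.of_isVariant ho.variant_left
  obtain ⟨k, f, ts, hl, hk, hts⟩ := hβ.of_isVariant ho.variant_right
  have hp : p = [] := by
    cases p with
    | nil => rfl
    | cons i p =>
      rw [hl] at hu
      simp only [subtermAt] at hu
      split at hu
      · exact absurd hμ (hρ₁.lhs_subst_ne ((hts _).of_subtermAt hu) hv _ _)
      · cases hu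
  have hnv := ho.root_not_variant hp
  obtain ⟨e₁, h₁, h₁'⟩ := ho.variant_left
  obtain ⟨e₂, h₂, h₂'⟩ := ho.variant_right
  subst hp
  simp only [subtermAt, Option.some.injEq] at hu
  subst hu
  refine ⟨?_, μ ∘ e₁, μ ∘ e₂, ?_, ?_, ?_⟩
  · rintro rfl
    refine hnv ⟨e₂.symm.trans e₁, ?_, ?_⟩
    · rw [h₁, h₂, Term.relabel_relabel]
      congr 1
      funext x
      simp
    · rw [h₁', h₂', Term.relabel_relabel]
      congr 1
      funext x
      simp
  · rwa [← subst_relabel, ← subst_relabel, ← h₁, ← h₂]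
  · rw [← subst_relabel, ← h₁']
    simp [replaceAt]
  · rw [← subst_relabel, ← h₂']

theorem Rule.IsRewriteRule.rhs_subst_eq {ρ : Rule} (hρ : ρ.IsRewriteRule) {σ τ : ℕ → Term}
    (h : ρ.lhs.subst σ = ρ.lhs.subst τ) : ρ.rhs.subst σ = ρ.rhs.subst τ :=
  subst_eq_subst_iff.2 fun x hx => subst_eq_subst_iff.1 h x (hρ.2 hx)

theorem Step.not_of_isConstructorTerm {ρ : Rule} (hρ : ρ.IsConstructorRule) {s t : Term}
    (hs : IsConstructorTerm s) : ¬ Step ρ s t := by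
  induction s generalizing t with
  | var x =>
    intro h
    obtain ⟨σ, hs, -⟩ | ⟨_, _, _, _, _, hs, -, -⟩ := h.cases_root_or_arg
    · obtain ⟨_, _, _, h, -⟩ := hρ.exists_eq_lhs_subst hs
      cases h
    · cases hs
  | func f ts ih =>
    intro h
    obtain ⟨σ, h, -⟩ | ⟨_, _, _, i, t', h, -, h'⟩ := h.cases_root_or_arg
    · obtain ⟨_, _, _, h, hk⟩ := hρ.exists_eq_lhs_subst h
      cases h
      exact absurd hs.1 (by lia)
    · cases h
      exact ih i (hs.2 i) h'

/-- A step from a symbol that is applied to constructor terms is a root step. -/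
theorem Step.exists_root {ρ : Rule} (hρ : ρ.IsConstructorRule) {k : ℕ} {f : sig.Functions k}
    {ts : Fin k → Term} (hts : ∀ i, IsConstructorTerm (ts i)) {t : Term}
    (h : Step ρ (Term.func f ts) t) :
    ∃ σ, Term.func f ts = ρ.lhs.subst σ ∧ t = ρ.rhs.subst σ := by
  obtain h | ⟨_, _, _, i, t', h, -, h'⟩ := h.cases_root_or_arg
  · exact h
  · cases h
    exact absurd h' (Step.not_of_isConstructorTerm hρ (hts i))

/-! ### Stack machines as rewrite systems -/

/-- A deterministic machine with four stacks. In state `q` it inspects the top of the stack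
`key q` (`none` for the empty stack); it then halts, or moves to a new state and replaces the
inspected symbol by a word. -/
structure StackMachine (Q Γ : Type) where
  key : Q → Fin 4
  trans : Q → Option Γ → Option (Q × List Γ)

namespace StackMachine

variable {Q Γ : Type}

/-- The transition function on configurations; the value is `none` if the machine halts. -/
def step (M : StackMachine Q Γ) (c : Q × (Fin 4 → List Γ)) : Option (Q × (Fin 4 → List Γ)) :=
  (M.trans c.1 (c.2 (M.key c.1)).head?).map fun r =>
    (r.1, Function.update c.2 (M.key c.1) (r.2 ++ (c.2 (M.key c.1)).tail))

end StackMachine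

/-- The constant for the empty stack. -/
def nilTerm : Term := Term.func (L := sig) (l := 0) (0 : ℕ) Fin.elim0

/-- Further constants, named by positive numbers since `0` names the empty stack. -/
def constTerm (n : ℕ) : Term := Term.func (L := sig) (l := 0) (n + 1 : ℕ) Fin.elim0

/-- The pair `p(s, t)`, for the only binary function symbol `p` in use. -/
def pairTerm (s t : Term) : Term := Term.func (L := sig) (l := 2) (0 : ℕ) ![s, t]

/-- The stack with content `w` on top of `t`: stack symbols are unary function symbols. -/
def stackTerm {Γ : Type} [Encodable Γ] (w : List Γ) (t : Term) : Term :=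
  w.foldr (fun a s => Term.func (L := sig) (l := 1) (Encodable.encode a : ℕ) fun _ => s) t

/-- A state, applied to the four stacks. -/
def stateTerm {Q : Type} [Encodable Q] (q : Q) (ts : Fin 4 → Term) : Term :=
  Term.func (L := sig) (l := 4) (Encodable.encode q : ℕ) ts

/-- The ground term that represents a configuration. -/
def configTerm {Q Γ : Type} [Encodable Q] [Encodable Γ] (c : Q × (Fin 4 → List Γ)) : Term :=
  stateTerm c.1 fun i => stackTerm (c.2 i) nilTerm

theorem nilTerm_subst (σ : ℕ → Term) : nilTerm.subst σ = nilTerm := by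
  simp only [nilTerm, Term.subst, Term.func.injEq, heq_eq_eq, true_and]
  exact funext fun i => i.elim0

theorem constTerm_subst (n : ℕ) (σ : ℕ → Term) : (constTerm n).subst σ = constTerm n := by
  simp only [constTerm, Term.subst, Term.func.injEq, heq_eq_eq, true_and]
  exact funext fun i => i.elim0

theorem pairTerm_subst (s t : Term) (σ : ℕ → Term) :
    (pairTerm s t).subst σ = pairTerm (s.subst σ) (t.subst σ) := by
  simp only [pairTerm, Term.subst, Term.func.injEq, heq_eq_eq, true_and]
  funext i
  fin_cases i <;> rfl

theorem pairTerm_inj {s t s' t' : Term} (h : pairTerm s t = pairTerm s' t') :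
    s = s' ∧ t = t' := by
  simp only [pairTerm, Term.func.injEq, heq_eq_eq, true_and] at h
  exact ⟨congrFun h 0, congrFun h 1⟩

theorem constTerm_inj {m n : ℕ} (h : constTerm m = constTerm n) : m = n := by
  simp only [constTerm, Term.func.injEq, heq_eq_eq, true_and, and_true] at h
  exact Nat.succ_injective h

section

variable {Q Γ : Type} [Encodable Γ]

theorem stackTerm_subst (w : List Γ) (t : Term) (σ : ℕ → Term) :
    (stackTerm w t).subst σ = stackTerm w (t.subst σ) := by
  induction w with
  | nil => rfl
  | cons a w ih =>
    simp only [stackTerm, List.foldr_cons, Term.subst] at ih ⊢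
    rw [ih]

theorem stackTerm_append (v w : List Γ) (t : Term) :
    stackTerm (v ++ w) t = stackTerm v (stackTerm w t) := by
  simp [stackTerm, List.foldr_append]

theorem varList_stackTerm (w : List Γ) (t : Term) : varList (stackTerm w t) = varList t := by
  induction w with
  | nil => rfl
  | cons a w ih =>
    simp only [stackTerm, List.foldr_cons] at ih ⊢
    simp [varList, ih, List.finRange_succ]

theorem varList_nilTerm : varList nilTerm = [] := rfl

theorem varList_constTerm (n : ℕ) : varList (constTerm n) = [] := rfl

theorem varList_pairTerm (s t : Term) : varList (pairTerm s t) = varList s ++ varList t := by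
  simp [pairTerm, varList, List.finRange_succ]

theorem IsConstructorTerm.stackTerm (w : List Γ) {t : Term} (ht : IsConstructorTerm t) :
    IsConstructorTerm (stackTerm w t) := by
  induction w with
  | nil => exact ht
  | cons a w ih => exact ⟨le_rfl, fun _ => ih⟩

theorem isConstructorTerm_nilTerm : IsConstructorTerm nilTerm := ⟨zero_le_one, fun i => i.elim0⟩

theorem isConstructorTerm_constTerm (n : ℕ) : IsConstructorTerm (constTerm n) :=
  ⟨zero_le_one, fun i => i.elim0⟩

/-- The argument pattern of a machine rule: the stack `k` with content `w` on top of the part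
that the rule leaves alone, and variables for the other stacks. If `h` is `none`, the stack `k`
is inspected and found to be empty, and this part is the empty stack. -/
def slots (k : Fin 4) (h : Option Γ) (w : List Γ) (i : Fin 4) : Term :=
  if i = k then stackTerm w (if h.isSome then Term.var (i : ℕ) else nilTerm)
  else Term.var (i : ℕ)

namespace StackMachine

variable (M : StackMachine Q Γ)

/-- The substitution that matches the applicable rule against a configuration. -/
def matcher (c : Q × (Fin 4 → List Γ)) (x : ℕ) : Term :=
  if h : x < 4 then
    stackTerm (if (⟨x, h⟩ : Fin 4) = M.key c.1 then (c.2 ⟨x, h⟩).tail else c.2 ⟨x, h⟩) nilTerm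
  else nilTerm

theorem slots_subst_matcher (c : Q × (Fin 4 → List Γ)) (w : List Γ) (i : Fin 4) :
    (slots (M.key c.1) (c.2 (M.key c.1)).head? w i).subst (M.matcher c) =
      stackTerm (Function.update c.2 (M.key c.1) (w ++ (c.2 (M.key c.1)).tail) i) nilTerm := by
  by_cases hi : i = M.key c.1
  · subst hi
    rw [Function.update_self, slots, if_pos rfl, stackTerm_subst, stackTerm_append]
    cases hc : c.2 (M.key c.1) with
    | nil => simp [nilTerm_subst, stackTerm]
    | cons a l => simp [Term.subst, matcher, hc]
  · simp [slots, hi, Term.subst, matcher]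

end StackMachine

variable [Encodable Q]

theorem stateTerm_subst (q : Q) (ts : Fin 4 → Term) (σ : ℕ → Term) :
    (stateTerm q ts).subst σ = stateTerm q fun i => (ts i).subst σ := rfl

theorem stateTerm_inj {q q' : Q} {ts ts' : Fin 4 → Term} (h : stateTerm q ts = stateTerm q' ts') :
    q = q' ∧ ts = ts' := by
  simp only [stateTerm, Term.func.injEq, heq_eq_eq, true_and] at h
  exact ⟨Encodable.encode_injective h.1, h.2⟩

theorem stateTerm_ne_pairTerm (q : Q) (ts : Fin 4 → Term) (s t : Term) :
    stateTerm q ts ≠ pairTerm s t := by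
  simp [stateTerm, pairTerm]

namespace StackMachine

variable (M : StackMachine Q Γ)

/-- The rule for state `q` and inspected symbol `h`. When the machine halts, the configuration
is discarded and rewritten to a fixed pair. -/
def rule (q : Q) (h : Option Γ) : Rule where
  lhs := stateTerm q (slots (M.key q) h h.toList)
  rhs := match M.trans q h with
    | none => pairTerm (constTerm 1) (constTerm 0)
    | some r => stateTerm r.1 (slots (M.key q) h r.2)

end StackMachine

theorem isConstructorTerm_slots (k : Fin 4) (h : Option Γ) (w : List Γ) (i : Fin 4) :
    IsConstructorTerm (slots k h w i) := by
  unfold slots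
  split_ifs
  · exact .stackTerm w trivial
  · exact .stackTerm w isConstructorTerm_nilTerm
  · trivial

theorem varList_slots (k : Fin 4) (h : Option Γ) (w : List Γ) (i : Fin 4) :
    varList (slots k h w i) = if i = k ∧ h = none then [] else [(i : ℕ)] := by
  unfold slots
  cases h <;> by_cases hi : i = k <;> simp [hi, varList_stackTerm, varList_nilTerm, varList]

theorem varList_stateTerm_slots (q : Q) (k : Fin 4) (h : Option Γ) (w : List Γ) :
    varList (stateTerm q (slots k h w)) =
      (List.finRange 4).flatMap fun i => if i = k ∧ h = none then [] else [(i : ℕ)] := by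
  simp only [stateTerm, varList, varList_slots]

theorem linearTerm_stateTerm_slots (q : Q) (k : Fin 4) (h : Option Γ) (w : List Γ) :
    LinearTerm (stateTerm q (slots k h w)) := by
  rw [LinearTerm, varList_stateTerm_slots]
  cases h with
  | none => simp only [and_true]; revert k; decide
  | some a => simp only [reduceCtorEq, and_false, if_false]; decide

namespace StackMachine

variable (M : StackMachine Q Γ)

theorem rule_isConstructorRule (q : Q) (h : Option Γ) : (M.rule q h).IsConstructorRule :=
  ⟨4, _, _, rfl, by norm_num, isConstructorTerm_slots _ _ _⟩

theorem rule_linear (q : Q) (h : Option Γ) : (M.rule q h).Linear := by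
  refine ⟨linearTerm_stateTerm_slots _ _ _ _, ?_⟩
  simp only [rule]
  split
  · simp [LinearTerm, varList_pairTerm, varList_constTerm]
  · exact linearTerm_stateTerm_slots _ _ _ _

theorem rule_isRewriteRule (q : Q) (h : Option Γ) : (M.rule q h).IsRewriteRule := by
  refine ⟨fun ⟨x, hx⟩ => (by cases hx), ?_⟩
  simp only [rule]
  split
  · simp [varList_pairTerm, varList_constTerm]
  · rw [varList_stateTerm_slots, varList_stateTerm_slots]
    exact List.Subset.refl _

theorem rule_lhs_subst_ne_pairTerm (q : Q) (h : Option Γ) (σ : ℕ → Term) (s t : Term) :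
    (M.rule q h).lhs.subst σ ≠ pairTerm s t :=
  stateTerm_ne_pairTerm _ _ _ _

/-- The machine rules are pairwise non-overlapping. -/
theorem rule_inj_of_unify {q q' : Q} {h h' : Option Γ} {σ τ : ℕ → Term}
    (heq : (M.rule q h).lhs.subst σ = (M.rule q' h').lhs.subst τ) : q = q' ∧ h = h' := by
  obtain ⟨rfl, hs⟩ := stateTerm_inj heq
  refine ⟨rfl, ?_⟩
  have := congrFun hs (M.key q)
  cases h <;> cases h' <;>
    simp only [slots, if_true, stackTerm_subst] at this <;>
    simp [stackTerm, nilTerm, Term.subst] at this ⊢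
  exact this.1

theorem rule_lhs_subst_matcher (c : Q × (Fin 4 → List Γ)) :
    (M.rule c.1 (c.2 (M.key c.1)).head?).lhs.subst (M.matcher c) = configTerm c := by
  simp only [rule, stateTerm_subst, slots_subst_matcher, configTerm]
  congr 1
  funext i
  congr 1
  rw [Function.update_eq_self_iff.2]
  cases c.2 (M.key c.1) <;> rfl

theorem rule_rhs_subst_matcher (c : Q × (Fin 4 → List Γ)) :
    (M.rule c.1 (c.2 (M.key c.1)).head?).rhs.subst (M.matcher c) =
      (M.step c).elim (pairTerm (constTerm 1) (constTerm 0)) configTerm := by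
  cases h : M.trans c.1 (c.2 (M.key c.1)).head? with
  | none => simp [rule, step, h, pairTerm_subst, constTerm_subst]
  | some r => simp [rule, step, h, stateTerm_subst, slots_subst_matcher, configTerm]

end StackMachine

end

/-! ### The rewrite system of a machine and an initial configuration -/

/-- The rule `p(0, 1) → t`, where `t` is to represent the initial configuration. -/
def startRule (t : Term) : Rule := ⟨pairTerm (constTerm 0) (constTerm 1), t⟩

/-- The rule `p(x, y) → p(y, x)`. -/
def swapRule : Rule :=
  ⟨pairTerm (Term.var 0) (Term.var 1), pairTerm (Term.var 1) (Term.var 0)⟩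

theorem swapRule_ne_startRule (t : Term) : swapRule ≠ startRule t := by
  intro h
  have := (pairTerm_inj (congrArg Rule.lhs h)).1
  cases this

theorem isConstructorRule_pairTerm {s t : Term} (hs : IsConstructorTerm s)
    (ht : IsConstructorTerm t) (r : Term) : (Rule.mk (pairTerm s t) r).IsConstructorRule := by
  refine ⟨2, _, _, rfl, le_rfl, fun i => ?_⟩
  fin_cases i
  exacts [hs, ht]

theorem swapRule_lhs_subst (σ : ℕ → Term) : swapRule.lhs.subst σ = pairTerm (σ 0) (σ 1) :=
  pairTerm_subst _ _ _

theorem swapRule_rhs_subst (σ : ℕ → Term) : swapRule.rhs.subst σ = pairTerm (σ 1) (σ 0) :=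
  pairTerm_subst _ _ _

theorem startRule_lhs_subst (t : Term) (σ : ℕ → Term) :
    (startRule t).lhs.subst σ = pairTerm (constTerm 0) (constTerm 1) := by
  simp [startRule, pairTerm_subst, constTerm_subst]

theorem step_swapRule (s t : Term) : Step swapRule (pairTerm s t) (pairTerm t s) := by
  have := Step.root (ρ := swapRule) (fun x => if x = 0 then s else t)
  rwa [swapRule_lhs_subst, swapRule_rhs_subst] at this

section

variable {Q Γ : Type} [Encodable Q] [Encodable Γ]

theorem configTerm_subst (c : Q × (Fin 4 → List Γ)) (σ : ℕ → Term) :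
    (configTerm c).subst σ = configTerm c := by
  simp only [configTerm, stateTerm_subst, stackTerm_subst, nilTerm_subst]

theorem varList_configTerm (c : Q × (Fin 4 → List Γ)) : varList (configTerm c) = [] := by
  simp [configTerm, stateTerm, varList, varList_stackTerm, varList_nilTerm]

theorem startRule_rhs_subst (c : Q × (Fin 4 → List Γ)) (σ : ℕ → Term) :
    (startRule (configTerm c)).rhs.subst σ = configTerm c :=
  configTerm_subst c σ

theorem step_startRule (c : Q × (Fin 4 → List Γ)) : Step (startRule (configTerm c))
    (pairTerm (constTerm 0) (constTerm 1)) (configTerm c) := by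
  have := Step.root (ρ := startRule (configTerm c)) Term.var
  rwa [startRule_lhs_subst, startRule_rhs_subst] at this

theorem criticalPair_startRule_swapRule (c : Q × (Fin 4 → List Γ)) :
    CriticalPair (startRule (configTerm c)) swapRule (configTerm c)
      (pairTerm (constTerm 1) (constTerm 0)) := by
  refine ⟨startRule (configTerm c), swapRule, [],
    fun x => if x = 0 then constTerm 0 else if x = 1 then constTerm 1 else Term.var x,
    ⟨⟨Equiv.refl ℕ, ?_, ?_⟩, ⟨Equiv.refl ℕ, ?_, ?_⟩, ?_, ⟨swapRule.lhs, ?_, ?_, ?_, ?_⟩, ?_⟩,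
    ?_, ?_⟩
  · exact (Term.relabel_id _).symm
  · exact (Term.relabel_id _).symm
  · exact (Term.relabel_id _).symm
  · exact (Term.relabel_id _).symm
  · simp [Rule.vars, startRule, varList_pairTerm, varList_constTerm, varList_configTerm]
  · simp [subtermAt]
  · rintro ⟨x, hx⟩
    cases hx
  · rw [startRule_lhs_subst, swapRule_lhs_subst]
    simp
  · intro ν hν
    rw [startRule_lhs_subst, swapRule_lhs_subst] at hν
    obtain ⟨h0, h1⟩ := pairTerm_inj hν
    refine ⟨ν, fun x => ?_⟩
    by_cases hx0 : x = 0
    · simp [hx0, ← h0, constTerm_subst]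
    · by_cases hx1 : x = 1
      · simp [hx1, ← h1, constTerm_subst]
      · simp [hx0, hx1, Term.subst]
  · rintro - ⟨e, he, -⟩
    have h := congrArg (fun t : Term => t.subst Term.var) he
    simp only [subst_relabel, startRule_lhs_subst, swapRule_lhs_subst] at h
    cases (pairTerm_inj h).1
  · simp [replaceAt, startRule_rhs_subst]
  · rw [swapRule_rhs_subst]
    simp

namespace StackMachine

variable [Fintype Q] [Fintype Γ] (M : StackMachine Q Γ)

/-- The rules that simulate the machine. -/
noncomputable def rules : List Rule :=
  (Finset.univ : Finset (Q × Option Γ)).toList.map fun p => M.rule p.1 p.2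

theorem mem_rules {ρ : Rule} : ρ ∈ M.rules ↔ ∃ q h, M.rule q h = ρ := by
  simp [rules]

/-- The machine rules, together with rules that make `p(0, 1)` a peak between the initial
configuration `c` and the swapped pair `p(1, 0)`. -/
noncomputable def toTRS (c : Q × (Fin 4 → List Γ)) : List Rule :=
  startRule (configTerm c) :: swapRule :: M.rules

variable (c : Q × (Fin 4 → List Γ))

theorem forall_mem_toTRS {P : Rule → Prop} :
    (∀ ρ ∈ M.toTRS c, P ρ) ↔
      P (startRule (configTerm c)) ∧ P swapRule ∧ ∀ q h, P (M.rule q h) := by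
  simp only [toTRS, List.forall_mem_cons, mem_rules]
  grind

theorem toTRS_isConstructorRule : ∀ ρ ∈ M.toTRS c, ρ.IsConstructorRule :=
  (M.forall_mem_toTRS c).2
    ⟨isConstructorRule_pairTerm (isConstructorTerm_constTerm 0) (isConstructorTerm_constTerm 1) _,
      isConstructorRule_pairTerm (s := .var 0) (t := .var 1) trivial trivial _, M.rule_isConstructorRule⟩

theorem isTRS_toTRS : IsTRS (M.toTRS c) :=
  (M.forall_mem_toTRS c).2
    ⟨⟨fun ⟨x, hx⟩ => (by cases hx), by simp [startRule, varList_configTerm]⟩,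
      ⟨fun ⟨x, hx⟩ => (by cases hx), by simp [swapRule, varList_pairTerm, varList]⟩,
      M.rule_isRewriteRule⟩

theorem linearTRS_toTRS : LinearTRS (M.toTRS c) :=
  (M.forall_mem_toTRS c).2
    ⟨⟨by simp [startRule, LinearTerm, varList_pairTerm, varList_constTerm],
        by simp [startRule, LinearTerm, varList_configTerm]⟩,
      ⟨by simp [swapRule, LinearTerm, varList_pairTerm, varList],
        by simp [swapRule, LinearTerm, varList_pairTerm, varList]⟩,
      M.rule_linear⟩

theorem startRule_mem_toTRS : startRule (configTerm c) ∈ M.toTRS c := by simp [toTRS]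

theorem swapRule_mem_toTRS : swapRule ∈ M.toTRS c := by simp [toTRS]

theorem rules_subset_toTRS : M.rules ⊆ M.toTRS c := by
  intro ρ hρ
  simp [toTRS, hρ]

/-- Different rules overlap only at `p(0, 1)`. -/
theorem root_peak_cases {ρ₁ ρ₂ : Rule} (h₁ : ρ₁ ∈ M.toTRS c) (h₂ : ρ₂ ∈ M.toTRS c)
    {σ τ : ℕ → Term} (h : ρ₁.lhs.subst σ = ρ₂.lhs.subst τ) :
    ρ₁ = ρ₂ ∨
      (ρ₁ = startRule (configTerm c) ∧ ρ₂ = swapRule ∧ ρ₁.rhs.subst σ = configTerm c ∧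
        ρ₂.rhs.subst τ = pairTerm (constTerm 1) (constTerm 0)) ∨
      (ρ₁ = swapRule ∧ ρ₂ = startRule (configTerm c) ∧
        ρ₁.rhs.subst σ = pairTerm (constTerm 1) (constTerm 0) ∧
        ρ₂.rhs.subst τ = configTerm c) := by
  simp only [toTRS, List.mem_cons, mem_rules] at h₁ h₂
  obtain rfl | rfl | ⟨q, k, rfl⟩ := h₁ <;> obtain rfl | rfl | ⟨q', k', rfl⟩ := h₂
  · exact .inl rfl
  · rw [startRule_lhs_subst, swapRule_lhs_subst] at h
    obtain ⟨h0, h1⟩ := pairTerm_inj h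
    exact .inr (.inl ⟨rfl, rfl, startRule_rhs_subst _ _, by rw [swapRule_rhs_subst, h0, h1]⟩)
  · rw [startRule_lhs_subst] at h
    exact absurd h.symm (M.rule_lhs_subst_ne_pairTerm _ _ _ _ _)
  · rw [startRule_lhs_subst, swapRule_lhs_subst] at h
    obtain ⟨h0, h1⟩ := pairTerm_inj h
    exact .inr (.inr ⟨rfl, rfl, by rw [swapRule_rhs_subst, h0, h1], startRule_rhs_subst _ _⟩)
  · exact .inl rfl
  · rw [swapRule_lhs_subst] at h
    exact absurd h.symm (M.rule_lhs_subst_ne_pairTerm _ _ _ _ _)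
  · rw [startRule_lhs_subst] at h
    exact absurd h (M.rule_lhs_subst_ne_pairTerm _ _ _ _ _)
  · rw [swapRule_lhs_subst] at h
    exact absurd h (M.rule_lhs_subst_ne_pairTerm _ _ _ _ _)
  · obtain ⟨rfl, rfl⟩ := M.rule_inj_of_unify h
    exact .inl rfl

/-- The swapped pair can always be swapped back, whence it reaches the initial configuration. -/
theorem reflTransGen_swapped_pair : ReflTransGen (Rewrites (M.toTRS c))
    (pairTerm (constTerm 1) (constTerm 0)) (configTerm c) :=
  .head ⟨_, M.swapRule_mem_toTRS c, step_swapRule _ _⟩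
    (.single ⟨_, M.startRule_mem_toTRS c, step_startRule c⟩)

theorem locallyConfluent_toTRS : LocallyConfluent (M.toTRS c) := by
  refine locallyConfluent_of_root_peaks (M.toTRS_isConstructorRule c) (M.linearTRS_toTRS c) ?_
  intro ρ₁ h₁ ρ₂ h₂ σ₁ σ₂ h
  obtain rfl | ⟨-, -, hs, ht⟩ | ⟨-, -, hs, ht⟩ := M.root_peak_cases c h₁ h₂ h
  · rw [(M.isTRS_toTRS c ρ₁ h₁).rhs_subst_eq h]
    exact ⟨_, .refl, .refl⟩
  · rw [hs, ht]
    exact ⟨_, .refl, M.reflTransGen_swapped_pair c⟩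
  · rw [hs, ht]
    exact ⟨_, M.reflTransGen_swapped_pair c, .refl⟩

theorem rewrites_rules_configTerm (d : Q × (Fin 4 → List Γ)) :
    Rewrites M.rules (configTerm d)
      ((M.step d).elim (pairTerm (constTerm 1) (constTerm 0)) configTerm) := by
  rw [← rule_rhs_subst_matcher, ← M.rule_lhs_subst_matcher]
  exact Rewrites.root (M.mem_rules.2 ⟨_, _, rfl⟩) _

theorem reflTransGen_rules_of_dom (h : (StateTransition.eval M.step c).Dom) :
    ReflTransGen (Rewrites M.rules) (configTerm c) (pairTerm (constTerm 1) (constTerm 0)) := by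
  obtain ⟨d, hd⟩ := Part.dom_iff_mem.1 h
  obtain ⟨hcd, hd⟩ := StateTransition.mem_eval.1 hd
  refine ReflTransGen.tail (b := configTerm d) (hcd.lift configTerm fun a b hab => ?_) ?_
  · have := M.rewrites_rules_configTerm a
    rwa [Option.mem_def.1 hab] at this
  · have := M.rewrites_rules_configTerm d
    rwa [hd] at this

/-- As long as the machine does not halt, its configurations rewrite to configurations only. -/
theorem eq_configTerm_of_step {ρ : Rule} (hρ : ρ ∈ M.toTRS c) {d d' : Q × (Fin 4 → List Γ)}
    (hd : M.step d = some d') {t : Term} (h : Step ρ (configTerm d) t) : t = configTerm d' := by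
  obtain ⟨σ, hs, rfl⟩ := h.exists_root (M.toTRS_isConstructorRule c ρ hρ)
    fun i => .stackTerm _ isConstructorTerm_nilTerm
  change configTerm d = _ at hs
  simp only [toTRS, List.mem_cons, mem_rules] at hρ
  obtain rfl | rfl | ⟨q, k, rfl⟩ := hρ
  · rw [startRule_lhs_subst] at hs
    exact absurd hs (stateTerm_ne_pairTerm _ _ _ _)
  · rw [swapRule_lhs_subst] at hs
    exact absurd hs (stateTerm_ne_pairTerm _ _ _ _)
  · rw [← rule_lhs_subst_matcher M] at hs
    obtain ⟨rfl, rfl⟩ := M.rule_inj_of_unify hs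
    rw [← (M.rule_isRewriteRule _ _).rhs_subst_eq hs, rule_rhs_subst_matcher, hd,
      Option.elim_some]

/-- Only the two auxiliary rules apply to a pair of constants. -/
theorem step_pairTerm_constTerm_cases {ρ : Rule} (hρ : ρ ∈ M.toTRS c) {m n : ℕ} {t : Term}
    (h : Step ρ (pairTerm (constTerm m) (constTerm n)) t) :
    ρ = startRule (configTerm c) ∧ m = 0 ∧ n = 1 ∨
      ρ = swapRule ∧ t = pairTerm (constTerm n) (constTerm m) := by
  obtain ⟨σ, hs, rfl⟩ := h.exists_root (M.toTRS_isConstructorRule c ρ hρ) (by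
    intro i
    fin_cases i
    exacts [isConstructorTerm_constTerm m, isConstructorTerm_constTerm n])
  change pairTerm _ _ = _ at hs
  simp only [toTRS, List.mem_cons, mem_rules] at hρ
  obtain rfl | rfl | ⟨q, k, rfl⟩ := hρ
  · rw [startRule_lhs_subst] at hs
    obtain ⟨hm, hn⟩ := pairTerm_inj hs
    exact .inl ⟨rfl, constTerm_inj hm, constTerm_inj hn⟩
  · rw [swapRule_lhs_subst] at hs
    obtain ⟨hm, hn⟩ := pairTerm_inj hs
    exact .inr ⟨rfl, by rw [swapRule_rhs_subst, hm, hn]⟩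
  · exact absurd hs.symm (M.rule_lhs_subst_ne_pairTerm _ _ _ _ _)

theorem ruleLabelingDecreasing_of_dom (h : (StateTransition.eval M.step c).Dom) :
    RuleLabelingDecreasing (M.toTRS c) := by
  classical
  -- The machine rules are below the two auxiliary rules.
  let rank : {ρ // ρ ∈ M.toTRS c} → ℕ := fun ρ => if ρ.1 ∈ M.rules then 0 else 1
  refine ⟨fun ρ₁ ρ₂ => rank ρ₁ < rank ρ₂, ?_, (measure rank).wf, ?_⟩
  · exact { irrefl := fun _ => lt_irrefl _, trans := fun _ _ _ => lt_trans }
  have not_mem : ∀ ρ : Rule, (∃ s t, ρ.lhs = pairTerm s t) → ρ ∉ M.rules := by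
    rintro _ ⟨s, t, hst⟩ hρ
    obtain ⟨q, k, rfl⟩ := M.mem_rules.1 hρ
    exact stateTerm_ne_pairTerm _ _ _ _ hst
  -- Below any auxiliary rule, the initial configuration reaches the swapped pair.
  have reach : ∀ α : {ρ // ρ ∈ M.toTRS c}, α.1 ∉ M.rules →
      ReflTransGen (StepBelow (fun ρ₁ ρ₂ => rank ρ₁ < rank ρ₂) α) (configTerm c)
        (pairTerm (constTerm 1) (constTerm 0)) := by
    intro α hα
    refine ReflTransGen.mono ?_ _ _ (M.reflTransGen_rules_of_dom c h)
    rintro s t ⟨ρ, hρ, hst⟩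
    exact ⟨⟨ρ, M.rules_subset_toTRS c hρ⟩, by simp [rank, hρ, hα], hst⟩
  rintro ⟨α, hα⟩ ⟨β, hβ⟩ s t hcp
  obtain ⟨hne, σ, τ, hστ, rfl, rfl⟩ := hcp.exists_root_peak
    (M.toTRS_isConstructorRule c α hα) (M.toTRS_isConstructorRule c β hβ)
  refine ⟨pairTerm (constTerm 1) (constTerm 0), ?_⟩
  obtain h | ⟨rfl, rfl, hs, ht⟩ | ⟨rfl, rfl, hs, ht⟩ := M.root_peak_cases c hα hβ hστ
  · exact absurd h hne
  · rw [hs, ht]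
    exact ⟨⟨_, _, reach _ (not_mem _ ⟨_, _, rfl⟩), .refl, .refl⟩, ⟨_, _, .refl, .refl, .refl⟩⟩
  · rw [hs, ht]
    exact ⟨⟨_, _, .refl, .refl, .refl⟩, ⟨_, _, reach _ (not_mem _ ⟨_, _, rfl⟩), .refl, .refl⟩⟩

/-- If the machine runs forever, then the swapped pair meets the reducts of the initial
configuration only after a swap that is followed by a start, for which the swap rule would have
to be both below and above the start rule. -/
theorem dom_of_ruleLabelingDecreasing (h : RuleLabelingDecreasing (M.toTRS c)) :
    (StateTransition.eval M.step c).Dom := by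
  by_contra hdom
  obtain ⟨lt, hlt, -, h⟩ := h
  let α : {ρ // ρ ∈ M.toTRS c} := ⟨_, M.startRule_mem_toTRS c⟩
  let β : {ρ // ρ ∈ M.toTRS c} := ⟨_, M.swapRule_mem_toTRS c⟩
  obtain ⟨u, ⟨s₁, s₂, hs₁, hs₂, hs₃⟩, ⟨t₁, t₂, ht₁, ht₂, ht₃⟩⟩ :=
    h α β _ _ (criticalPair_startRule_swapRule c)
  -- All reducts of the initial configuration are configurations.
  let IsReached : Term → Prop := fun t =>
    ∃ d, StateTransition.Reaches M.step c d ∧ t = configTerm d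
  have hstep : ∀ (ρ : {ρ // ρ ∈ M.toTRS c}) (s t : Term), IsReached s → Step ρ.1 s t →
      IsReached t := by
    rintro ⟨ρ, hρ⟩ s t ⟨d, hd, rfl⟩ hst
    cases hd' : M.step d with
    | none => exact absurd (Part.dom_iff_mem.2 ⟨d, StateTransition.mem_eval.2 ⟨hd, hd'⟩⟩) hdom
    | some d' => exact ⟨d', hd.tail hd', M.eq_configTerm_of_step c hρ hd' hst⟩
  have hu : IsReached u := by
    have h₁ : IsReached s₁ := by
      clear hs₂ hs₃
      induction hs₁ with
      | refl => exact ⟨c, .refl, rfl⟩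
      | tail _ hab ih => obtain ⟨γ, -, hγ⟩ := hab; exact hstep γ _ _ ih hγ
    have h₂ : IsReached s₂ := by
      cases hs₂ with
      | refl => exact h₁
      | single hab => obtain ⟨γ, -, hγ⟩ := hab; exact hstep γ _ _ h₁ hγ
    clear ht₃
    induction hs₃ with
    | refl => exact h₂
    | tail _ hab ih => obtain ⟨γ, -, hγ⟩ | ⟨γ, -, hγ⟩ := hab <;> exact hstep γ _ _ ih hγ
  -- The decreasing reducts of the swapped pair are pairs.
  have hαβ : α ≠ β := fun h => swapRule_ne_startRule _ (congrArg Subtype.val h).symm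
  have cases_swapped : ∀ (γ : {ρ // ρ ∈ M.toTRS c}) (t : Term),
      Step γ.1 (pairTerm (constTerm 1) (constTerm 0)) t →
      γ = β ∧ t = pairTerm (constTerm 0) (constTerm 1) := by
    intro γ t hγ
    obtain ⟨-, h, -⟩ | ⟨h, ht⟩ := M.step_pairTerm_constTerm_cases c γ.2 hγ
    · cases h
    · exact ⟨Subtype.ext h, ht⟩
  have h₁ : t₁ = pairTerm (constTerm 1) (constTerm 0) := by
    clear ht₂ ht₃
    induction ht₁ with
    | refl => rfl
    | tail _ hab ih =>
      obtain ⟨γ, hlt', hγ⟩ := hab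
      obtain ⟨rfl, -⟩ := cases_swapped γ _ (ih ▸ hγ)
      exact absurd hlt' (hlt.irrefl β)
  subst h₁
  have hnot : ¬ IsReached (pairTerm (constTerm 1) (constTerm 0)) ∧
      ¬ IsReached (pairTerm (constTerm 0) (constTerm 1)) :=
    ⟨fun ⟨_, _, h⟩ => stateTerm_ne_pairTerm _ _ _ _ h.symm,
      fun ⟨_, _, h⟩ => stateTerm_ne_pairTerm _ _ _ _ h.symm⟩
  -- If the swap rule is below the start rule, then the latter cannot be used after the middle step
  -- of the diagram; otherwise the former cannot be used at all.
  by_cases hlt' : lt β α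
  · have hstay : ∀ (γ : {ρ // ρ ∈ M.toTRS c}) (s t : Term),
        (s = pairTerm (constTerm 1) (constTerm 0) ∨ s = pairTerm (constTerm 0) (constTerm 1)) →
        γ ≠ α → Step γ.1 s t →
        (t = pairTerm (constTerm 1) (constTerm 0) ∨ t = pairTerm (constTerm 0) (constTerm 1)) := by
      rintro γ s t (rfl | rfl) hγα hγ
      · exact .inr (cases_swapped γ t hγ).2
      · obtain ⟨h, -⟩ | ⟨-, ht⟩ := M.step_pairTerm_constTerm_cases c γ.2 hγ
        · exact absurd (Subtype.ext h) hγα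
        · exact .inl ht
    have h₂ : t₂ = pairTerm (constTerm 1) (constTerm 0) ∨
        t₂ = pairTerm (constTerm 0) (constTerm 1) := by
      cases ht₂ with
      | refl => exact .inl rfl
      | single hab => obtain ⟨γ, -, hγ⟩ := hab; exact .inr (cases_swapped γ _ hγ).2
    have h₃ : u = pairTerm (constTerm 1) (constTerm 0) ∨
        u = pairTerm (constTerm 0) (constTerm 1) := by
      clear hs₃ hu
      induction ht₃ with
      | refl => exact h₂
      | tail _ hab ih =>
        obtain ⟨γ, hγ', hγ⟩ | ⟨γ, hγ', hγ⟩ := hab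
        · exact hstay γ _ _ ih (by rintro rfl; exact hlt.irrefl _ (hlt.trans _ _ _ hγ' hlt')) hγ
        · exact hstay γ _ _ ih (by rintro rfl; exact hlt.irrefl _ hγ') hγ
    obtain rfl | rfl := h₃
    exacts [hnot.1 hu, hnot.2 hu]
  · have h₂ : t₂ = pairTerm (constTerm 1) (constTerm 0) := by
      cases ht₂ with
      | refl => rfl
      | single hab =>
        obtain ⟨γ, hγ', hγ⟩ := hab
        obtain ⟨rfl, -⟩ := cases_swapped γ _ hγ
        exact absurd hγ' (not_or.2 ⟨hlt', hαβ.symm⟩)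
    have h₃ : u = pairTerm (constTerm 1) (constTerm 0) := by
      clear hs₃ hu
      induction ht₃ with
      | refl => exact h₂
      | tail _ hab ih =>
        subst ih
        obtain ⟨γ, hγ', hγ⟩ | ⟨γ, hγ', hγ⟩ := hab
        · obtain ⟨rfl, -⟩ := cases_swapped γ _ hγ
          exact absurd hγ' (hlt.irrefl β)
        · obtain ⟨rfl, -⟩ := cases_swapped γ _ hγ
          exact absurd hγ' hlt'
    exact hnot.1 (h₃ ▸ hu)

end StackMachine

end

/-! ### An undecidable halting problem for a fixed stack machine -/

namespace StackMachine

variable {Q Γ : Type}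

/-- The restriction of a machine to a set of states that its transitions do not leave. -/
def restrict (M : StackMachine Q Γ) (F : Set Q)
    (hF : ∀ q ∈ F, ∀ h, ∀ r ∈ M.trans q h, r.1 ∈ F) : StackMachine F Γ where
  key q := M.key q
  trans q h := (M.trans q h).pmap (fun r hr => (⟨r.1, hr⟩, r.2)) (hF q q.2 h)

theorem eval_step_restrict_dom (M : StackMachine Q Γ) (F : Set Q)
    (hF : ∀ q ∈ F, ∀ h, ∀ r ∈ M.trans q h, r.1 ∈ F) (q : F) (S : Fin 4 → List Γ) :
    (StateTransition.eval (M.restrict F hF).step (q, S)).Dom ↔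
      (StateTransition.eval M.step ((q : Q), S)).Dom := by
  refine (StateTransition.tr_eval_dom (tr := fun c d => c = (Prod.map Subtype.val id d))
    (f₁ := M.step) (f₂ := (M.restrict F hF).step) ?_ rfl)
  rintro _ ⟨q, S⟩ rfl
  cases hr : M.trans q (S (M.key q)).head? with
  | none => simp [step, restrict, hr]
  | some r =>
    have hr' := hF q q.2 _ r hr
    simp only [step, Prod.map, id, hr, Option.map_some]
    refine ⟨(⟨r.1, hr'⟩, Function.update S (M.key q) (r.2 ++ (S (M.key q)).tail)), rfl,
      .single ?_⟩
    simp [restrict, step, hr]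

end StackMachine

section TM2

open Turing

variable {K Γ Λ σ : Type}

/-- The stack machine that executes a program of the `TM2` model one elementary instruction at a
time; its states are the statements that remain to be executed (`none` after the end of the
program), together with the values of the local variables. -/
def ofTM2 (M : Λ → TM2.Stmt (fun _ : K => Γ) Λ σ) (e : K ≃ Fin 4) :
    StackMachine (Option (TM2.Stmt (fun _ : K => Γ) Λ σ) × σ) Γ where
  key
    | (some (.push k _ _), _) => e k
    | (some (.peek k _ _), _) => e k
    | (some (.pop k _ _), _) => e k
    | _ => 0
  trans
    | (some (.push _ f q), v), h => some ((some q, v), f v :: h.toList)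
    | (some (.peek _ f q), v), h => some ((some q, f v h), h.toList)
    | (some (.pop _ f q), v), h => some ((some q, f v h), [])
    | (some (.load f q), v), h => some ((some q, f v), h.toList)
    | (some (.branch p q₁ q₂), v), h => some ((some (cond (p v) q₁ q₂), v), h.toList)
    | (some (.goto l), v), h => some ((some (M (l v)), v), h.toList)
    | (some .halt, v), h => some ((none, v), h.toList)
    | (none, _), _ => none

variable (M : Λ → TM2.Stmt (fun _ : K => Γ) Λ σ) (e : K ≃ Fin 4)

/-- The states that occur while a program with labels in `L` is executed. -/
def tm2States (L : Finset Λ) : Set (Option (TM2.Stmt (fun _ : K => Γ) Λ σ) × σ) :=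
  {p | p.1 ∈ TM2.stmts M L}

theorem some_mem_stmts {L : Finset Λ} {l : Λ} (hl : l ∈ L) : some (M l) ∈ TM2.stmts M L := by
  simp only [TM2.stmts, Finset.some_mem_insertNone, Finset.mem_biUnion]
  exact ⟨l, hl, TM2.stmts₁_self⟩

theorem finite_tm2States [Finite σ] (L : Finset Λ) : (tm2States M L).Finite := by
  have := (TM2.stmts M L).finite_toSet.prod (Set.finite_univ (α := σ))
  exact this.subset fun p hp => ⟨hp, trivial⟩

theorem trans_ofTM2_mem [Inhabited Λ] {L : Finset Λ} (hL : TM2.Supports M L) :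
    ∀ q ∈ tm2States M L, ∀ h, ∀ r ∈ (ofTM2 M e).trans q h, r.1 ∈ tm2States M L := by
  have sub : ∀ {s t : TM2.Stmt (fun _ : K => Γ) Λ σ}, some s ∈ TM2.stmts M L →
      t ∈ TM2.stmts₁ s → some t ∈ TM2.stmts M L := fun h ht => TM2.stmts_trans ht h
  rintro ⟨_ | s, v⟩ hq h r hr
  · cases hr
  change some s ∈ TM2.stmts M L at hq
  change r.1.1 ∈ TM2.stmts M L
  cases s <;> simp only [ofTM2, Option.mem_def, Option.some.injEq] at hr <;> subst hr
  case goto l => exact some_mem_stmts M (TM2.stmts_supportsStmt hL hq v)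
  case halt => simp [TM2.stmts]
  case branch p _ _ =>
    refine sub hq ?_
    cases p v <;> simp [TM2.stmts₁, TM2.stmts₁_self]
  all_goals exact sub hq (by simp [TM2.stmts₁, TM2.stmts₁_self])

variable [DecidableEq K]

/-- The configuration of `ofTM2 M e` that corresponds to a configuration of the program, with the
next statement in place of its label. -/
def ofTM2Cfg (c : TM2.Cfg (fun _ : K => Γ) Λ σ) :
    (Option (TM2.Stmt (fun _ : K => Γ) Λ σ) × σ) × (Fin 4 → List Γ) :=
  ((c.l.map M, c.var), fun i => c.stk (e.symm i))

theorem head?_toList_append_tail (l : List Γ) : l.head?.toList ++ l.tail = l := by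
  cases l <;> rfl

theorem update_comp_symm (S : K → List Γ) (k : K) (l : List Γ) :
    (fun i => Function.update S k l (e.symm i)) =
      Function.update (fun i => S (e.symm i)) (e k) l := by
  funext i
  by_cases h : i = e k
  · subst h; simp
  · rw [Function.update_of_ne h, Function.update_of_ne (by rintro rfl; simp at h)]

/-- A single step of the program runs through a whole statement, which takes the stack machine at
least one step. -/
theorem reaches₁_ofTM2_stepAux (s : TM2.Stmt (fun _ : K => Γ) Λ σ) (v : σ) (S : K → List Γ) :
    StateTransition.Reaches₁ (ofTM2 M e).step ((some s, v), fun i => S (e.symm i))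
      (ofTM2Cfg M e (TM2.stepAux s v S)) := by
  induction s generalizing v S with
  | push k f q ih =>
    refine .head ?_ (ih v _)
    simp [StackMachine.step, ofTM2, update_comp_symm, head?_toList_append_tail]
  | peek k f q ih =>
    refine .head ?_ (ih _ S)
    simp [StackMachine.step, ofTM2, head?_toList_append_tail]
  | pop k f q ih =>
    refine .head ?_ (ih _ _)
    simp [StackMachine.step, ofTM2, update_comp_symm]
  | load f q ih =>
    refine .head ?_ (ih _ S)
    simp [StackMachine.step, ofTM2, head?_toList_append_tail]
  | branch p q₁ q₂ ih₁ ih₂ =>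
    cases hp : p v with
    | true =>
      rw [TM2.stepAux, hp]
      refine .head ?_ (ih₁ v S)
      simp [StackMachine.step, ofTM2, head?_toList_append_tail, hp]
    | false =>
      rw [TM2.stepAux, hp]
      refine .head ?_ (ih₂ v S)
      simp [StackMachine.step, ofTM2, head?_toList_append_tail, hp]
  | goto l =>
    refine .single ?_
    simp [StackMachine.step, ofTM2, head?_toList_append_tail, ofTM2Cfg]
  | halt =>
    refine .single ?_
    simp [StackMachine.step, ofTM2, head?_toList_append_tail, ofTM2Cfg]

theorem eval_step_ofTM2_dom (c : TM2.Cfg (fun _ : K => Γ) Λ σ) :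
    (StateTransition.eval (ofTM2 M e).step (ofTM2Cfg M e c)).Dom ↔
      (StateTransition.eval (TM2.step M) c).Dom := by
  refine StateTransition.tr_eval_dom (tr := fun c d => ofTM2Cfg M e c = d) ?_ rfl
  rintro ⟨_ | l, v, S⟩ _ rfl
  · rfl
  · exact ⟨_, rfl, reaches₁_ofTM2_stepAux M e (M l) v S⟩

end TM2

open Turing PartrecToTM2 in
/-- The binary digits of `n`, in any fixed numbering of the alphabet, are primitive recursive
in `n`. -/
theorem primrec_map_trNat (f : Γ' → ℕ) : Primrec fun n => (trNat n).map f := by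
  have rec_eq : ∀ n, (trNat n).map f = if n = 0 then [] else
      (if n % 2 = 0 then f .bit0 else f .bit1) :: (trNat (n / 2)).map f := by
    intro n
    obtain ⟨m, rfl | rfl⟩ := n.even_or_odd'
    · cases hm : (m : Num) with
      | zero =>
        have : m = 0 := by simpa using congrArg (fun k : Num => (k : ℕ)) hm
        subst this; simp
      | pos k =>
        have h0 : m ≠ 0 := by rintro rfl; cases hm
        have : ((2 * m : ℕ) : Num) = .pos k.bit0 := by
          rw [two_mul, Nat.cast_add, hm]; exact congrArg Num.pos (PosNum.bit0_of_bit0 k)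
        simp [h0, trNat, this, hm, trNum, trPosNum]
    · have : ((2 * m + 1 : ℕ) : Num) = (m : Num).bit1 := by
        rw [two_mul, Nat.cast_add, Nat.cast_add]; exact Num.bit1_of_bit1 _
      have h2 : (2 * m + 1) / 2 = m := by lia
      rw [h2]
      simp only [trNat, this]
      cases (m : Num) <;> simp [Num.bit1, trNum, trPosNum]
  have : Primrec₂ fun (_ : Unit) n => (trNat n).map f := by
    refine Primrec.nat_strong_rec _ (g := fun _ l => if l.length = 0 then some [] else
      (l[l.length / 2]?).map fun w => (if l.length % 2 = 0 then f .bit0 else f .bit1) :: w) ?_ ?_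
    · have hlen : Primrec fun p : Unit × List (List ℕ) => p.2.length :=
        Primrec.list_length.comp .snd
      refine Primrec.ite (Primrec.eq.comp hlen (.const 0)) (.const _) (Primrec.option_map
        (Primrec.list_getElem?.comp .snd (Primrec.nat_div.comp hlen (.const 2))) ?_)
      exact Primrec.list_cons.comp (Primrec.ite (Primrec.eq.comp (Primrec.nat_mod.comp
        (hlen.comp .fst) (.const 2)) (.const 0)) (.const _) (.const _)) .snd
    · intro _ n
      simp only [List.length_map, List.length_range]
      rw [rec_eq n]
      by_cases h0 : n = 0
      · simp [h0]
      · simp [h0, List.getElem?_range (Nat.div_lt_self (Nat.pos_of_ne_zero h0) one_lt_two)]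
  exact this.comp (.const ()) .id

open Turing PartrecToTM2 in
/-- There is a stack machine whose halting problem is undecidable, for initial configurations
that are primitive recursive in the input. -/
theorem exists_undecidable_stackMachine :
    ∃ (Q Γ : Type) (_ : Finite Q) (_ : Finite Γ) (M : StackMachine Q Γ) (q : Q)
      (S : ℕ → Fin 4 → List Γ),
      (∀ (f : Γ → ℕ) (i : Fin 4), Primrec fun n => (S n i).map f) ∧
      ¬ ComputablePred fun n => (StateTransition.eval M.step (q, S n)).Dom := by
  -- A universal partial recursive function.
  let U : ℕ →. ℕ := fun n => (Denumerable.ofNat Nat.Partrec.Code n).eval 0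
  have hU : Partrec U := Nat.Partrec.Code.eval_part.comp (Computable.ofNat _) (.const 0)
  obtain ⟨c, hc⟩ := ToPartrec.Code.exists_code (Nat.Partrec'.part_iff₁.2 hU)
  have hsupp := tr_supports c Cont'.halt
  let e : K' ≃ Fin 4 :=
    { toFun := fun
        | .main => 0
        | .rev => 1
        | .aux => 2
        | .stack => 3
      invFun := ![.main, .rev, .aux, .stack]
      left_inv := by rintro (_ | _ | _ | _) <;> rfl
      right_inv := by decide }
  have hmem := @trans_ofTM2_mem K' Γ' Λ' (Option Γ') tr e ⟨trNormal c Cont'.halt⟩ _ hsupp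
  let F := tm2States tr (codeSupp c Cont'.halt)
  have hq : (some (tr (trNormal c Cont'.halt)), none) ∈ F := by
    change some _ ∈ TM2.stmts _ _
    exact some_mem_stmts tr hsupp.1
  refine ⟨F, Γ', (finite_tm2States tr _).to_subtype, inferInstance,
    (ofTM2 tr e).restrict F hmem, ⟨_, hq⟩,
    fun n i => K'.elim (trList [n]) [] [] [] (e.symm i), ?_, ?_⟩
  · intro f i
    have : ∀ k, Primrec fun n => (K'.elim (trList [n]) [] [] [] k).map f := by
      rintro (_ | _ | _ | _)
      · simpa using Primrec.list_append.comp (primrec_map_trNat f) (.const [f .cons])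
      all_goals exact .const []
    exact this (e.symm i)
  · intro h
    refine ComputablePred.halting_problem 0 (ComputablePred.computable_of_manyOneReducible
      ⟨Encodable.encode, Computable.encode, fun d => ?_⟩ h)
    refine Iff.trans ?_ (StackMachine.eval_step_restrict_dom _ _ hmem _ _).symm
    have h₁ := eval_step_ofTM2_dom tr e (init c [Encodable.encode d])
    have h₂ : (StateTransition.eval (TM2.step tr) (init c [Encodable.encode d])).Dom ↔
        (d.eval 0).Dom := by
      rw [tr_eval]
      have := hc (Encodable.encode d ::ᵥ List.Vector.nil)
      simp only [List.Vector.head_cons] at this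
      change c.eval [Encodable.encode d] = _ at this
      rw [this]
      simp [U]
    exact h₂.symm.trans h₁.symm

/-! ### The reduction -/

section

variable {Q Γ : Type} [Encodable Q] [Encodable Γ]

theorem encodeTerm_func {k : ℕ} (f : sig.Functions k) (ts : Fin k → Term) :
    encodeTerm (Term.func f ts) =
      Sum.inr (k, f) :: (List.finRange k).flatMap fun i => encodeTerm (ts i) := by
  simp [encodeTerm, Term.listEncode, List.map_flatMap]

theorem encodeTerm_stackTerm (w : List Γ) (t : Term) :
    encodeTerm (stackTerm w t) =
      (w.map Encodable.encode).map (fun a => Sum.inr (1, a)) ++ encodeTerm t := by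
  induction w with
  | nil => rfl
  | cons a w ih =>
    simp only [stackTerm, List.foldr_cons] at ih ⊢
    simp [encodeTerm_func, ih, List.finRange_succ]

theorem primrec_encodeTRS_toTRS [Fintype Q] [Fintype Γ] (M : StackMachine Q Γ) (q : Q)
    (S : ℕ → Fin 4 → List Γ) (hS : ∀ i, Primrec fun n => (S n i).map Encodable.encode) :
    Primrec fun n => encodeTRS (M.toTRS (q, S n)) := by
  have hstack : ∀ i, Primrec fun n => encodeTerm (stackTerm (S n i) nilTerm) := by
    intro i
    simp only [encodeTerm_stackTerm]
    exact Primrec.list_append.comp (Primrec.list_map (hS i)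
      (Primrec.sumInr.comp (Primrec.pair (.const 1) .snd))) (.const _)
  have hconfig : Primrec fun n => encodeTerm (configTerm (q, S n)) := by
    simp only [configTerm, stateTerm, encodeTerm_func]
    refine Primrec.list_cons.comp (.const _) ?_
    simp only [List.finRange_succ, List.finRange_zero, List.map_nil, List.map_cons,
      List.flatMap_cons, List.flatMap_nil]
    exact Primrec.list_append.comp (hstack _) (Primrec.list_append.comp (hstack _)
      (Primrec.list_append.comp (hstack _) (Primrec.list_append.comp (hstack _) (.const _))))
  simp only [encodeTRS, StackMachine.toTRS, List.map_cons]
  exact Primrec.list_cons.comp (Primrec.pair (.const _) hconfig) (.const _)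

end

end TRS

/-- No partial recursive procedure halts with the correct answer on every finite, locally
confluent, linear term rewrite system (its behaviour on other inputs is unconstrained). -/
theorem mainTheorem5 :
    ¬ ∃ f : List (List TRS.Token × List TRS.Token) →. Bool, Partrec f ∧
      ∀ R : List TRS.Rule, TRS.IsTRS R → TRS.LinearTRS R → TRS.LocallyConfluent R →
        ∃ b ∈ f (TRS.encodeTRS R), (b = true ↔ TRS.RuleLabelingDecreasing R) := by
  rintro ⟨f, hf, h⟩
  obtain ⟨Q, Γ, _, _, M, q, S, hS, hM⟩ := TRS.exists_undecidable_stackMachine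
  -- The names of the states and of the stack symbols are arbitrary numberings.
  have := Fintype.ofFinite Q
  have := Fintype.ofFinite Γ
  have := Encodable.ofCountable Q
  have := Encodable.ofCountable Γ
  have henc := (TRS.primrec_encodeTRS_toTRS M q S (hS _)).to_comp
  choose b hb hbR using fun n => h _ (M.isTRS_toTRS (q, S n)) (M.linearTRS_toTRS (q, S n))
    (M.locallyConfluent_toTRS (q, S n))
  have hcomp : Computable b := (hf.comp henc).of_eq fun n => Part.eq_some_iff.2 (hb n)
  refine hM (ComputablePred.computable_iff.2 ⟨b, hcomp, funext fun n => propext ?_⟩)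
  exact ⟨fun hd => (hbR n).2 (M.ruleLabelingDecreasing_of_dom _ hd),
    fun hd => M.dom_of_ruleLabelingDecreasing _ ((hbR n).1 hd)⟩
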